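/- Let $H$ be a finite-dimensional complex vector space with a real structure (a conjugate-linear involution $x\mapsto\bar x$), and let $(H,W,F)$ be a mixed Hodge structure defined over $\mathbb{R}$: $W_\bullet$ is a finite increasing filtration of $H$ defined over $\mathbb{R}$, $F^\bullet$ is a finite decreasing filtration of $H$, and for every $k\in\mathbb{Z}$ the filtration induced by $F$ on $\mathrm{Gr}^W_kH=W_k/W_{k-1}$ is the Hodge filtration of a pure Hodge structure of weight $k$. Let $d\in\mathbb{Z}$ and let $N$ be a nilpotent endomorphism of $H$ such that (a) $N$ is a morphism of real mixed Hodge structures of type $(-1,-1)$, i.e. $N$ is defined over $\mathbb{R}$, $NW_k\subset W_{k-2}$ and $NF^p\subset F^{p-1}$ for all $k,p\in\mathbb{Z}$; (b) $W=W(N,d)$ is the monodromy weight filtration of $N$ centered at $d$, i.e. $N^l:\mathrm{Gr}^W_{d+l}H\to\mathrm{Gr}^W_{d-l}H$ is an isomorphism for all $l\ge 0$. Then there is a constant $C\in\mathbb{R}$ such that for every $z\in\mathbb{C}$ with $\mathrm{Im}(z)>C$ the filtration $\exp(zN)F^\bullet$ is $d$-opposed to its complex conjugate, i.e. $$H=\exp(zN)F^p\oplus\overline{\exp(zN)F^{d-p+1}}\qquad\text{for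 all } p\in\mathbb{Z}.$$ -/

import Mathlib

noncomputable section

/-- A real structure on a complex vector space `H`: a conjugate-linear involution `x ↦ x̄`.
Its fixed vectors form the real subspace `H_ℝ`, and `H = H_ℝ ⊗ ℂ`. -/
structure RealStructure (H : Type*) [AddCommGroup H] [Module ℂ H] where
  /-- complex conjugation -/
  conj : H →ₛₗ[starRingEnd ℂ] H
  conj_conj : ∀ x, conj (conj x) = x

/-- The complex conjugate `S̄` of a subspace `S`. -/
def RealStructure.conjSubmodule {H : Type*} [AddCommGroup H] [Module ℂ H]
    (σ : RealStructure H) (S : Submodule ℂ H) : Submodule ℂ H :=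
  S.map σ.conj

/-- A finite (exhaustive and separated) decreasing filtration. -/
structure IsFiniteDecreasing {H : Type*} [AddCommGroup H] [Module ℂ H]
    (F : ℤ → Submodule ℂ H) : Prop where
  antitone : Antitone F
  exists_eq_top : ∃ p, F p = ⊤
  exists_eq_bot : ∃ p, F p = ⊥

/-- A finite (exhaustive and separated) increasing filtration. -/
structure IsFiniteIncreasing {H : Type*} [AddCommGroup H] [Module ℂ H]
    (W : ℤ → Submodule ℂ H) : Prop where
  monotone : Monotone W
  exists_eq_bot : ∃ k, W k = ⊥
  exists_eq_top : ∃ k, W k = ⊤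

/-- Two decreasing filtrations are `d`-opposed: `F^p ⊕ G^{d-p+1} = H` for every `p`. -/
def IsOpposed {H : Type*} [AddCommGroup H] [Module ℂ H] (d : ℤ)
    (F G : ℤ → Submodule ℂ H) : Prop :=
  ∀ p : ℤ, IsCompl (F p) (G (d - p + 1))

/-- `F` is the Hodge filtration of a real pure Hodge structure of weight `k`. -/
structure IsPureHodgeStructure {H : Type*} [AddCommGroup H] [Module ℂ H]
    (σ : RealStructure H) (k : ℤ) (F : ℤ → Submodule ℂ H) : Prop where
  finite : IsFiniteDecreasing F
  opposed : IsOpposed k F (fun p => σ.conjSubmodule (F p))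

/-- The graded piece `Gr^W_k H = W_k / W_{k-1}` (for an increasing filtration `W`). -/
abbrev Gr {H : Type*} [AddCommGroup H] [Module ℂ H] (W : ℤ → Submodule ℂ H) (k : ℤ) : Type _ :=
  ↥(W k) ⧸ (W (k - 1)).submoduleOf (W k)

/-- The filtration induced by `F` on `Gr^W_k H`: the image of `F^p ∩ W_k`. -/
def grFiltration {H : Type*} [AddCommGroup H] [Module ℂ H] (W F : ℤ → Submodule ℂ H)
    (k p : ℤ) : Submodule ℂ (Gr W k) :=
  ((F p).submoduleOf (W k)).map ((W (k - 1)).submoduleOf (W k)).mkQ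

/-- The (semi)linear map `Gr^W_a H → Gr^W_b H` induced by a (semi)linear map `f` of `H` with
`f W_a ⊆ W_b` and `f W_{a-1} ⊆ W_{b-1}`. -/
def grMap {H : Type*} [AddCommGroup H] [Module ℂ H] {τ : ℂ →+* ℂ} (W : ℤ → Submodule ℂ H)
    (f : H →ₛₗ[τ] H) (a b : ℤ) (h : ∀ x ∈ W a, f x ∈ W b)
    (h' : ∀ x ∈ W (a - 1), f x ∈ W (b - 1)) : Gr W a →ₛₗ[τ] Gr W b :=
  Submodule.mapQ ((W (a - 1)).submoduleOf (W a)) ((W (b - 1)).submoduleOf (W b))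
    ((f.comp (W a).subtype).codRestrict (W b) (fun x => h x x.2)) (fun x hx => h' x hx)

/-- The real structure induced on `Gr^W_k H`, for `W` defined over `ℝ`. -/
def RealStructure.gr {H : Type*} [AddCommGroup H] [Module ℂ H] (σ : RealStructure H)
    (W : ℤ → Submodule ℂ H) (hW : ∀ k, ∀ x ∈ W k, σ.conj x ∈ W k) (k : ℤ) :
    RealStructure (Gr W k) where
  conj := grMap W σ.conj k k (hW k) (hW (k - 1))
  conj_conj := by
    intro x
    obtain ⟨x, rfl⟩ := Submodule.mkQ_surjective _ x
    exact congrArg (Submodule.mkQ _) (Subtype.ext (σ.conj_conj x))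

/-- `(H, W, F)` is a mixed Hodge structure defined over `ℝ`: `W` is a finite increasing filtration
defined over `ℝ`, `F` is a finite decreasing filtration, and `F` induces on each `Gr^W_k H` a real
pure Hodge structure of weight `k`. -/
structure IsRealMixedHodgeStructure {H : Type*} [AddCommGroup H] [Module ℂ H]
    (σ : RealStructure H) (W F : ℤ → Submodule ℂ H) : Prop where
  weight_finite : IsFiniteIncreasing W
  weight_real : ∀ k, ∀ x ∈ W k, σ.conj x ∈ W k
  hodge_finite : IsFiniteDecreasing F
  pure_gr : ∀ k, IsPureHodgeStructure (σ.gr W weight_real k) k (grFiltration W F k)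

/-- `f` is an endomorphism of type `(r, r)` of the real mixed Hodge structure `(H, W, F)`:
it is defined over `ℝ`, `f W_k ⊆ W_{k+2r}` and `f F^p ⊆ F^{p+r}`. -/
structure IsMorphismOfType {H : Type*} [AddCommGroup H] [Module ℂ H] (σ : RealStructure H)
    (W F : ℤ → Submodule ℂ H) (f : Module.End ℂ H) (r : ℤ) : Prop where
  map_conj : ∀ x, f (σ.conj x) = σ.conj (f x)
  map_weight : ∀ k, ∀ x ∈ W k, f x ∈ W (k + 2 * r)
  map_hodge : ∀ p, ∀ x ∈ F p, f x ∈ F (p + r)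

theorem pow_mem_of_shift {H : Type*} [AddCommGroup H] [Module ℂ H] {N : Module.End ℂ H}
    {W : ℤ → Submodule ℂ H} (hN : ∀ k, ∀ x ∈ W k, N x ∈ W (k - 2)) (l : ℕ) (a b : ℤ)
    (hab : b = a - 2 * l) (x : H) (hx : x ∈ W a) : (N ^ l) x ∈ W b := by
  induction l generalizing b with
  | zero =>
    obtain rfl : b = a := by simpa using hab
    simpa using hx
  | succ l ih =>
    obtain rfl : b = (a - 2 * l) - 2 := by rw [hab]; push_cast; ring
    rw [pow_succ', Module.End.mul_apply]
    exact hN _ _ (ih _ rfl)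

/-- `W = W(N, d)`, the monodromy weight filtration of `N` centered at `d`: the finite increasing
filtration with `N W_k ⊆ W_{k-2}` such that `N^l : Gr^W_{d+l} H → Gr^W_{d-l} H` is an isomorphism
for every `l ≥ 0`. -/
structure IsMonodromyWeightFiltration {H : Type*} [AddCommGroup H] [Module ℂ H]
    (N : Module.End ℂ H) (d : ℤ) (W : ℤ → Submodule ℂ H) : Prop where
  finite : IsFiniteIncreasing W
  shift : ∀ k, ∀ x ∈ W k, N x ∈ W (k - 2)
  bijective : ∀ l : ℕ, Function.Bijective
    (grMap W (N ^ l) (d + l) (d - l) (pow_mem_of_shift shift l _ _ (by ring))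
      (pow_mem_of_shift shift l _ _ (by ring)))

/-- `exp(zN) = ∑ z^k N^k / k!` for a nilpotent `N`; the sum runs over `k` below the nilpotency
class, the remaining terms being zero. -/
def expNilpotent {H : Type*} [AddCommGroup H] [Module ℂ H] (N : Module.End ℂ H) (z : ℂ) :
    Module.End ℂ H :=
  ∑ k ∈ Finset.range (nilpotencyClass N), (z ^ k / (k.factorial : ℂ)) • N ^ k

/-- The filtration `exp(zN) F^•`. -/
def expFiltration {H : Type*} [AddCommGroup H] [Module ℂ H] (N : Module.End ℂ H)
    (F : ℤ → Submodule ℂ H) (z : ℂ) (p : ℤ) : Submodule ℂ H :=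
  (F p).map (expNilpotent N z)

end

/-! Write G for the conjugate of F. Since N is real, exp(zN)F^p + conj(exp(zN)F^q) is the image
under exp(z̄N) of exp(wN)F^p + G^q with w = z - z̄. For p + q = d + 1 the dimensions of F^p and G^q
add up to dim H, because N^l identifies the Hodge numbers of weights d + l and d - l
(`finrank_add_finrank`). It therefore suffices that exp(wN)F^p + G^q = H outside a finite set of w
(`finite_setOf_expFiltration_sup_ne_top`): a large Im z avoids that set.

Put w = s² and give W_k the factor s^{-k}, so that s²N is homogeneous for the weights. As s → ∞ the
problem then reduces to the graded one, where H is a sum of N-strings generated by primitive vectors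
of pure type (a, b). On a string of length l + 1 the claim is that every t^j is e^t f + g modulo
t^{l+1} with prescribed degree bounds on f and g, i.e. that the Padé problem for exp is uniquely
solvable (`PowerSeries.exists_exp_mul_add`). Terms of lower weight carry an extra factor s⁻¹, and a
determinant argument in the style of Nakayama absorbs them for all but finitely many s. -/

noncomputable section

/-! ### Padé approximation of the exponential series. -/

section Pade


/-- Differentiating e^t f gives e^t (f' + f) and shortens the gap of vanishing coefficients by one.
By induction f' + f = 0, and its leading coefficient is that of f. -/
theorem PowerSeries.eq_zero_of_coeff_exp_mul_eq_zero (r s : ℕ) (f : Polynomial ℂ)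
    (hf : ∀ i, r ≤ i → f.coeff i = 0)
    (h : ∀ i, s ≤ i → i < r + s → PowerSeries.coeff i (PowerSeries.exp ℂ * (f : PowerSeries ℂ)) = 0) :
    f = 0 := by
  induction s generalizing f with
  | zero =>
    -- With s = 0 the product vanishes to order r; exp is a unit, so t^r divides f, whose degree is
    -- below r.
    have h1 : (X : PowerSeries ℂ) ^ r ∣ PowerSeries.exp ℂ * (f : PowerSeries ℂ) :=
      X_pow_dvd_iff.2 fun i hi => h i (Nat.zero_le _) (by simpa using hi)
    have h2 : (X : PowerSeries ℂ) ^ r ∣ (f : PowerSeries ℂ) := by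
      have h3 := h1.mul_left (evalNegHom (PowerSeries.exp ℂ))
      rwa [← mul_assoc, mul_comm (evalNegHom _), exp_mul_exp_neg_eq_one, one_mul] at h3
    ext i
    rcases lt_or_ge i r with hi | hi
    · simpa using X_pow_dvd_iff.1 h2 i hi
    · simpa using hf i hi
  | succ s ih =>
    have hg : f.derivative + f = 0 := by
      apply ih
      · intro i hi
        simp [Polynomial.coeff_derivative, hf i hi, hf (i + 1) (by omega)]
      · intro i hi hi'
        have h1 := h (i + 1) (by omega) (by omega)
        have h2 : PowerSeries.exp ℂ * ((f.derivative + f : Polynomial ℂ) : PowerSeries ℂ)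
            = PowerSeries.derivative ℂ (PowerSeries.exp ℂ * (f : PowerSeries ℂ)) := by
          rw [Derivation.leibniz, derivative_exp, derivative_coe]
          simp only [smul_eq_mul, Polynomial.coe_add]
          ring
        rw [h2, coeff_derivative, h1, zero_mul]
    by_contra hne
    have h1 := congrArg (fun q => q.coeff f.natDegree) hg
    simp [Polynomial.coeff_derivative] at h1
    exact hne h1


theorem PowerSeries.exists_exp_mul_add (r s j : ℕ) :
    ∃ f g : Polynomial ℂ, (∀ i, r ≤ i → f.coeff i = 0) ∧ (∀ i, s ≤ i → g.coeff i = 0) ∧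
      ∀ i, i < r + s → PowerSeries.coeff i (PowerSeries.exp ℂ * (f : PowerSeries ℂ)) + g.coeff i
        = (Polynomial.X ^ j : Polynomial ℂ).coeff i := by
  -- Only the coefficients s, …, r + s - 1 constrain f, since g can correct the first s. This is a
  -- square linear system, so injectivity gives solvability.
  let T : Polynomial.degreeLT ℂ r →ₗ[ℂ] (Fin r → ℂ) :=
    LinearMap.pi fun i => (PowerSeries.coeff (s + i)).comp
      ((LinearMap.mulLeft ℂ (PowerSeries.exp ℂ)).comp
        ((Polynomial.coeToPowerSeries.algHom ℂ (R := ℂ)).toLinearMap.comp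
          (Polynomial.degreeLT ℂ r).subtype))
  have hT : ∀ f i, T f i = PowerSeries.coeff (s + i)
      (PowerSeries.exp ℂ * ((f : Polynomial ℂ) : PowerSeries ℂ)) := by
    intro f i
    simp [T, Polynomial.coeToPowerSeries.algHom_apply]
  have hdeg : ∀ f : Polynomial.degreeLT ℂ r, ∀ i, r ≤ i → (f : Polynomial ℂ).coeff i = 0 := by
    intro f i hi
    exact Polynomial.coeff_eq_zero_of_degree_lt
      ((Polynomial.mem_degreeLT.1 f.2).trans_le (by exact_mod_cast hi))
  have hinj : Function.Injective T := by
    rw [← LinearMap.ker_eq_bot, LinearMap.ker_eq_bot']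
    intro f hf
    apply Subtype.ext
    refine PowerSeries.eq_zero_of_coeff_exp_mul_eq_zero r s f (hdeg f) fun i hi hi' => ?_
    have := hT f ⟨i - s, by omega⟩
    simp only [hf, Pi.zero_apply] at this
    rw [this]
    congr 2
    omega
  have hfin : Module.finrank ℂ (Polynomial.degreeLT ℂ r) = Module.finrank ℂ (Fin r → ℂ) :=
    (Polynomial.degreeLTEquiv ℂ r).finrank_eq
  have : FiniteDimensional ℂ (Polynomial.degreeLT ℂ r) :=
    Module.Finite.equiv (Polynomial.degreeLTEquiv ℂ r).symm
  have hsurj : Function.Surjective T :=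
    (LinearMap.injective_iff_surjective_of_finrank_eq_finrank hfin).1 hinj
  obtain ⟨f, hf⟩ := hsurj fun i => (Polynomial.X ^ j : Polynomial ℂ).coeff (s + i)
  refine ⟨f, PowerSeries.trunc s (((Polynomial.X ^ j : Polynomial ℂ) : PowerSeries ℂ) -
    PowerSeries.exp ℂ * ((f : Polynomial ℂ) : PowerSeries ℂ)), hdeg f, ?_, ?_⟩
  · intro i hi
    rw [coeff_trunc, if_neg (by omega)]
  · intro i hi
    rcases lt_or_ge i s with h | h
    · rw [coeff_trunc, if_pos h, map_sub, Polynomial.coeff_coe]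
      ring
    · rw [coeff_trunc, if_neg (by omega), add_zero]
      have := (hT f ⟨i - s, by omega⟩).symm
      rw [hf] at this
      simpa only [Nat.add_sub_cancel' h] using this

end Pade

/-! ### A determinant argument for families of subspaces. -/

section Nakayama

variable {H : Type*} [AddCommGroup H] [Module ℂ H]

/-- A finitely generated space `M` of `H`-valued functions which is contained, modulo functions with
`f s ∈ R s`, in `s⁻¹ • M`, takes values in `R s` for all but finitely many `s`. -/
theorem Submodule.FG.finite_setOf_not_forall_mem {M : Submodule ℂ (ℂ → H)} (hM : M.FG)
    (R : ℂ → Submodule ℂ H)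
    (h : ∀ f ∈ M, ∃ g ∈ M, ∀ s : ℂ, s ≠ 0 → f s - s⁻¹ • g s ∈ R s) :
    {s : ℂ | ¬ ∀ f ∈ M, f s ∈ R s}.Finite := by
  obtain ⟨n, e, he⟩ := Submodule.fg_iff_exists_fin_generating_family.1 hM
  have heM : ∀ i, e i ∈ M := fun i => he ▸ Submodule.subset_span ⟨i, rfl⟩
  choose g hgM hg using fun i => h (e i) (heM i)
  have : ∀ i, ∃ c : Fin n → ℂ, ∑ j, c j • e j = g i := fun i => by
    have := hgM i
    rwa [← he, Submodule.mem_span_range_iff_exists_fun] at this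
  choose B hB using this
  let b : Matrix (Fin n) (Fin n) ℂ := Matrix.of B
  have hfin : {s : ℂ | b.charpoly.IsRoot s}.Finite :=
    Polynomial.finite_setOfPred_isRoot b.charpoly_monic.ne_zero
  refine ((Set.finite_singleton (0 : ℂ)).union hfin).subset fun s hs => ?_
  by_contra hcon
  simp only [Set.singleton_union, Set.mem_insert_iff, Set.mem_ofPred_eq, not_or,
    Polynomial.IsRoot.def] at hcon
  obtain ⟨hs0, hdet⟩ := hcon
  rw [Matrix.eval_charpoly] at hdet
  apply hs
  -- The hypothesis multiplied by s says that A sends the vector of generators into `R s`;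
  -- multiplying by the adjugate gives det A • e_l ∈ `R s`.
  set A : Matrix (Fin n) (Fin n) ℂ := Matrix.scalar (Fin n) s - b with hA
  have hmem : ∀ i, ∑ j, A i j • e j s ∈ R s := by
    intro i
    have h1 := (R s).smul_mem s (hg i s hs0)
    convert h1 using 1
    rw [smul_sub, smul_inv_smul₀ hs0, ← hB i]
    simp [hA, b, sub_smul, Matrix.diagonal_apply, Finset.sum_sub_distrib]
  have he' : ∀ l, e l s ∈ R s := by
    intro l
    have h1 : ∑ i, A.adjugate l i • ∑ j, A i j • e j s ∈ R s :=
      Submodule.sum_mem _ fun i _ => (R s).smul_mem _ (hmem i)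
    have h2 : ∑ i, A.adjugate l i • ∑ j, A i j • e j s = A.det • e l s := by
      simp_rw [Finset.smul_sum, smul_smul]
      rw [Finset.sum_comm]
      simp_rw [← Finset.sum_smul, ← Matrix.mul_apply, Matrix.adjugate_mul]
      simp [Matrix.one_apply]
    rw [h2] at h1
    exact ((R s).smul_mem_iff hdet).1 h1
  intro f hf
  rw [← he] at hf
  obtain ⟨c, rfl⟩ := (Submodule.mem_span_range_iff_exists_fun ℂ).1 hf
  simp only [Finset.sum_apply, Pi.smul_apply]
  exact Submodule.sum_mem _ fun i _ => (R s).smul_mem _ (he' i)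

end Nakayama

/-! ### Opposed filtrations on the graded pieces, and rescaling by weight. -/

section Core

variable {H : Type*} [AddCommGroup H] [Module ℂ H]

/-- Decreasing filtrations `F`, `G` which are `k`-opposed on every `Gr^W_k`, where `W` is the
monodromy weight filtration centered at `d` of an endomorphism `N` shifting `W` by `-2` and `F`, `G`
by `-1`; all conditions are expressed by elements of `H`. -/
structure IsMonodromyOpposed (N : Module.End ℂ H) (d : ℤ) (W F G : ℤ → Submodule ℂ H) : Prop where
  monotone : Monotone W
  antitone_left : Antitone F
  antitone_right : Antitone G
  shift : ∀ k, ∀ x ∈ W k, N x ∈ W (k - 2)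
  shift_left : ∀ p, ∀ x ∈ F p, N x ∈ F (p - 1)
  shift_right : ∀ p, ∀ x ∈ G p, N x ∈ G (p - 1)
  exists_add : ∀ k p q, p + q = k + 1 → ∀ x ∈ W k,
    ∃ y ∈ F p, y ∈ W k ∧ ∃ z ∈ G q, z ∈ W k ∧ x - y - z ∈ W (k - 1)
  mem_of_sub_mem : ∀ k p q, p + q = k + 1 → ∀ y ∈ F p, y ∈ W k → ∀ z ∈ G q, z ∈ W k →
    y - z ∈ W (k - 1) → y ∈ W (k - 1)
  surj : ∀ l : ℕ, ∀ y ∈ W (d - l), ∃ x ∈ W (d + l), (N ^ l) x - y ∈ W (d - l - 1)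
  inj : ∀ l : ℕ, ∀ x ∈ W (d + l), (N ^ l) x ∈ W (d - l - 1) → x ∈ W (d + l - 1)

theorem pow_mem_of_shift_one {N : Module.End ℂ H} {F : ℤ → Submodule ℂ H}
    (hN : ∀ p, ∀ x ∈ F p, N x ∈ F (p - 1)) (l : ℕ) (a b : ℤ) (hab : b = a - l) (x : H)
    (hx : x ∈ F a) : (N ^ l) x ∈ F b := by
  induction l generalizing b with
  | zero =>
    obtain rfl : b = a := by simpa using hab
    simpa using hx
  | succ l ih =>
    obtain rfl : b = (a - l) - 1 := by rw [hab]; push_cast; ring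
    rw [pow_succ', Module.End.mul_apply]
    exact hN _ _ (ih _ rfl)

namespace IsMonodromyOpposed

variable {N : Module.End ℂ H} {d : ℤ} {W F G : ℤ → Submodule ℂ H}

theorem symm (h : IsMonodromyOpposed N d W F G) : IsMonodromyOpposed N d W G F where
  monotone := h.monotone
  antitone_left := h.antitone_right
  antitone_right := h.antitone_left
  shift := h.shift
  shift_left := h.shift_right
  shift_right := h.shift_left
  exists_add k p q hpq x hx := by
    obtain ⟨y, hy, hy', z, hz, hz', hxyz⟩ := h.exists_add k q p (by omega) x hx
    exact ⟨z, hz, hz', y, hy, hy', by rwa [sub_right_comm]⟩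
  mem_of_sub_mem k p q hpq y hy hy' z hz hz' hyz := by
    have h1 : z - y ∈ W (k - 1) := by simpa using neg_mem hyz
    have h2 := h.mem_of_sub_mem k q p (by omega) z hz hz' y hy hy' h1
    simpa using add_mem hyz h2
  surj := h.surj
  inj := h.inj

/-- Strictness: the isomorphisms `N^l` of graded pieces reflect the Hodge filtration. -/
theorem exists_sub_mem_of_pow_sub_mem (h : IsMonodromyOpposed N d W F G) (l : ℕ) (p p' : ℤ)
    (hp : p' = p - l) (x : H) (hx : x ∈ W (d + l)) (v : H) (hv : v ∈ F p') (hv' : v ∈ W (d - l))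
    (hxv : (N ^ l) x - v ∈ W (d - l - 1)) :
    ∃ y ∈ F p, y ∈ W (d + l) ∧ x - y ∈ W (d + l - 1) := by
  -- The G-part z is negligible: modulo lower weight, N^l z lies in F^{p-l} and in G^{d-p+1}, which
  -- are opposed in weight d - l, so `inj` applies.
  obtain ⟨y, hy, hy', z, hz, hz', hxyz⟩ := h.exists_add (d + l) p (d + l - p + 1) (by ring) x hx
  refine ⟨y, hy, hy', ?_⟩
  have hNy : (N ^ l) y ∈ F p' := pow_mem_of_shift_one h.shift_left l p p' hp y hy
  have hNy' : (N ^ l) y ∈ W (d - l) := pow_mem_of_shift h.shift l _ _ (by ring) y hy'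
  have hNz : (N ^ l) z ∈ G (d - p + 1) := pow_mem_of_shift_one h.shift_right l _ _ (by ring) z hz
  have hNz' : (N ^ l) z ∈ W (d - l) := pow_mem_of_shift h.shift l _ _ (by ring) z hz'
  have h1 : (N ^ l) (x - y - z) ∈ W (d - l - 1) := pow_mem_of_shift h.shift l _ _ (by ring) _ hxyz
  have h2 : v - (N ^ l) y - (N ^ l) z ∈ W (d - l - 1) := by
    have := sub_mem h1 hxv
    rw [map_sub, map_sub] at this
    convert this using 1
    abel
  have h3 := h.mem_of_sub_mem (d - l) p' (d - p + 1) (by rw [hp]; ring) _ (sub_mem hv hNy)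
    (sub_mem hv' hNy') _ hNz hNz' h2
  have h4 := h.inj l z hz' (by simpa using sub_mem h3 h2)
  simpa using add_mem hxyz h4

/-- A subspace containing the elements of `W_k` of pure Hodge type contains `W_k`. -/
theorem weight_le_of_forall_type (h : IsMonodromyOpposed N d W F G) (hF : ∃ p, F p = ⊤)
    (hF' : ∃ p, F p = ⊥) (k : ℤ) (S : Submodule ℂ H)
    (htype : ∀ a b, a + b = k → ∀ x ∈ F a, x ∈ W k → ∀ x' ∈ G b, x' ∈ W k → x - x' ∈ W (k - 1) →
      x ∈ S) : W k ≤ S := by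
  obtain ⟨p₀, hp₀⟩ := hF
  obtain ⟨p₁, hp₁⟩ := hF'
  -- Each step down in F is split off by opposedness: the remainder x - y lies in F^a and agrees
  -- with an element of G^b modulo W_{k-1}, where a + b = k.
  have key : ∀ n : ℕ, F (p₁ - n) ⊓ W k ≤ S := by
    intro n
    induction n with
    | zero => simp [hp₁]
    | succ n ih =>
      rintro x ⟨hx, hx'⟩
      obtain ⟨y, hy, hy', z, hz, hz', hxyz⟩ :=
        h.exists_add k (p₁ - n) (k - (p₁ - n) + 1) (by ring) x hx'
      have hy₁ : y ∈ F (p₁ - (n + 1 : ℕ)) := h.antitone_left (by push_cast; omega) hy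
      have := htype (p₁ - (n + 1 : ℕ)) (k - (p₁ - n) + 1) (by push_cast; ring) (x - y)
        (sub_mem hx hy₁) (sub_mem hx' hy') z hz hz' hxyz
      simpa using add_mem this (ih ⟨hy, hy'⟩)
  intro x hx
  refine key (p₁ - p₀).toNat ⟨h.antitone_left (show p₁ - ((p₁ - p₀).toNat : ℤ) ≤ p₀ by omega) ?_, hx⟩
  rw [hp₀]
  trivial

end IsMonodromyOpposed

section Exponential

variable {N : Module.End ℂ H}

theorem expNilpotent_eq_aeval (hN : IsNilpotent N) (w : ℂ) (m : ℕ) (hm : nilpotencyClass N ≤ m) :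
    expNilpotent N w = Polynomial.aeval (w • N) (PowerSeries.trunc m (PowerSeries.exp ℂ)) := by
  rw [expNilpotent, PowerSeries.trunc_apply, map_sum]
  have h : ∀ k, Polynomial.aeval (w • N) (Polynomial.monomial k
      (PowerSeries.coeff k (PowerSeries.exp ℂ))) = (w ^ k / (k.factorial : ℂ)) • N ^ k := by
    intro k
    rw [Polynomial.aeval_monomial, PowerSeries.coeff_exp, ← Algebra.smul_def, smul_pow, smul_smul]
    congr 1
    simp
    ring
  simp_rw [h]
  rw [Nat.Ico_zero_eq_range]
  refine Finset.sum_subset (Finset.range_mono hm) fun k _ hk => ?_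
  rw [Finset.mem_range, not_lt] at hk
  rw [pow_eq_zero_of_le hk (pow_nilpotencyClass hN), smul_zero]

end Exponential

/-- The function `s ↦ s^{-k} e`. -/
def scaled (k : ℤ) : H →ₗ[ℂ] (ℂ → H) :=
  LinearMap.pi fun s => s ^ (-k) • LinearMap.id

theorem scaled_apply (k : ℤ) (e : H) (s : ℂ) : scaled k e s = s ^ (-k) • e := rfl

/-- The functions spanned by `s ↦ s^{-(k + j)} e` for `e ∈ W_k` and `k ∈ [a, b]`. -/
def scaledSpan (W : ℤ → Submodule ℂ H) (a b j : ℤ) : Submodule ℂ (ℂ → H) :=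
  ⨆ k ∈ Finset.Icc a b, (W k).map (scaled (k + j))

theorem scaled_mem_scaledSpan {W : ℤ → Submodule ℂ H} (hW : Monotone W) {a b : ℤ} (ha : W a = ⊥)
    (j k : ℤ) (hk : k ≤ b) {e : H} (he : e ∈ W k) : scaled (k + j) e ∈ scaledSpan W a b j := by
  rcases lt_or_ge k a with h | h
  · have : e ∈ W a := hW h.le he
    rw [ha, Submodule.mem_bot] at this
    simp [this]
  · exact Submodule.mem_iSup_of_mem k (Submodule.mem_iSup_of_mem (Finset.mem_Icc.2 ⟨h, hk⟩)
      (Submodule.mem_map_of_mem he))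

theorem exists_scaledSpan_zero_eq {W : ℤ → Submodule ℂ H} {a b : ℤ} {f : ℂ → H}
    (hf : f ∈ scaledSpan W a b 1) :
    ∃ g ∈ scaledSpan W a b 0, ∀ s : ℂ, s ≠ 0 → f s = s⁻¹ • g s := by
  -- The generators match only for s ≠ 0, hence the second summand: functions supported at 0.
  have hle : scaledSpan W a b 1 ≤ ((scaledSpan W a b 0).map
      (LinearMap.pi fun s : ℂ => s⁻¹ • LinearMap.proj s)) ⊔
      Submodule.pi {0}ᶜ (fun _ => (⊥ : Submodule ℂ H)) := by
    refine iSup₂_le fun k hk => ?_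
    rintro _ ⟨e, he, rfl⟩
    have h1 : scaled k e ∈ scaledSpan W a b 0 :=
      Submodule.mem_iSup_of_mem k (Submodule.mem_iSup_of_mem hk
        (by simpa using Submodule.mem_map_of_mem (f := scaled (k + 0)) he))
    rw [← sub_add_cancel (scaled (k + 1) e)
      ((LinearMap.pi fun s : ℂ => s⁻¹ • LinearMap.proj s : (ℂ → H) →ₗ[ℂ] (ℂ → H)) (scaled k e)),
      add_comm]
    refine Submodule.add_mem_sup (Submodule.mem_map_of_mem h1) ?_
    intro s hs
    have hs : s ≠ 0 := hs
    simp only [Pi.sub_apply, LinearMap.pi_apply, LinearMap.smul_apply, LinearMap.proj_apply,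
      scaled_apply, smul_smul]
    rw [neg_add, zpow_add₀ hs, mul_comm, zpow_neg_one, sub_self]
    exact zero_mem _
  obtain ⟨_, ⟨g, hg, rfl⟩, r, hr, rfl⟩ := Submodule.mem_sup.1 (hle hf)
  refine ⟨g, hg, fun s hs => ?_⟩
  have : r s = 0 := by simpa using hr s hs
  simp [this]

theorem scaledSpan_fg [FiniteDimensional ℂ H] (W : ℤ → Submodule ℂ H) (a b j : ℤ) :
    (scaledSpan W a b j).FG :=
  Submodule.fg_biSup _ _ fun k _ => (IsNoetherian.noetherian (W k)).map _

end Core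

/-! ### Generic transversality of exp(wN)F^p and G^q. -/

section Core

variable {H : Type*} [AddCommGroup H] [Module ℂ H]

/-- The function `s ↦ s^{-k} P(s² N) x`, written out for a polynomial `P` as a linear combination
of the functions `s ↦ s^{2i-k} N^i x`. -/
def polyScaled (N : Module.End ℂ H) (k : ℤ) (x : H) : Polynomial ℂ →ₗ[ℂ] (ℂ → H) :=
  Polynomial.lsum fun i => LinearMap.toSpanSingleton ℂ _ (scaled (k - 2 * i) ((N ^ i) x))

section PolyScaled

variable {N : Module.End ℂ H} {k : ℤ}

theorem polyScaled_eq_sum (x : H) (P : Polynomial ℂ) :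
    polyScaled N k x P = ∑ i ∈ P.support, P.coeff i • scaled (k - 2 * i) ((N ^ i) x) := by
  simp [polyScaled, Polynomial.lsum_apply, Polynomial.sum_def]

theorem polyScaled_X_pow (x : H) (j : ℕ) :
    polyScaled N k x (Polynomial.X ^ j) = scaled (k - 2 * j) ((N ^ j) x) := by
  rw [polyScaled, Polynomial.lsum_apply, Polynomial.X_pow_eq_monomial, Polynomial.sum_monomial_index]
  · simp
  · simp

theorem polyScaled_sub (x y : H) (P : Polynomial ℂ) :
    polyScaled N k (x - y) P = polyScaled N k x P - polyScaled N k y P := by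
  simp [polyScaled_eq_sum, smul_sub, Finset.sum_sub_distrib]

theorem aeval_smul_apply_eq_sum (w : ℂ) (x : H) (P : Polynomial ℂ) :
    Polynomial.aeval (w • N) P x = ∑ i ∈ P.support, (P.coeff i * w ^ i) • (N ^ i) x := by
  rw [Polynomial.aeval_def, Polynomial.eval₂_eq_sum, Polynomial.sum_def, LinearMap.sum_apply]
  refine Finset.sum_congr rfl fun i _ => ?_
  rw [← Algebra.smul_def, smul_pow, smul_smul, LinearMap.smul_apply]

theorem polyScaled_apply (x : H) (P : Polynomial ℂ) {s : ℂ} (hs : s ≠ 0) :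
    polyScaled N k x P s = s ^ (-k) • Polynomial.aeval (s ^ 2 • N) P x := by
  rw [polyScaled_eq_sum, aeval_smul_apply_eq_sum, Finset.smul_sum, Finset.sum_apply]
  refine Finset.sum_congr rfl fun i _ => ?_
  rw [Pi.smul_apply, scaled_apply, smul_smul, smul_smul, neg_sub, sub_eq_neg_add, zpow_add₀ hs,
    zpow_mul, zpow_natCast]
  congr 1
  norm_cast
  ring

theorem aeval_smul_apply_mem {F : ℤ → Submodule ℂ H} (hF : Antitone F)
    (hN : ∀ p, ∀ x ∈ F p, N x ∈ F (p - 1)) (w : ℂ) {a p : ℤ} {x : H} (hx : x ∈ F a)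
    {P : Polynomial ℂ} (hP : ∀ i : ℕ, a - i < p → P.coeff i = 0) :
    Polynomial.aeval (w • N) P x ∈ F p := by
  rw [aeval_smul_apply_eq_sum]
  refine Submodule.sum_mem _ fun i hi => Submodule.smul_mem _ _ ?_
  have : p ≤ a - i := by
    by_contra hlt
    exact Polynomial.mem_support_iff.1 hi (hP i (not_le.1 hlt))
  exact hF this (pow_mem_of_shift_one hN i a _ rfl x hx)

theorem polyScaled_mem_scaledSpan {W : ℤ → Submodule ℂ H} (hW : Monotone W) {a b : ℤ}
    (ha : W a = ⊥) (hb : k ≤ b) {x : H} {P : Polynomial ℂ}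
    (hP : ∀ i : ℕ, P.coeff i ≠ 0 → (N ^ i) x ∈ W (k - 2 * i - 1)) :
    polyScaled N k x P ∈ scaledSpan W a b 1 := by
  rw [polyScaled_eq_sum]
  refine Submodule.sum_mem _ fun i hi => Submodule.smul_mem _ _ ?_
  have := scaled_mem_scaledSpan hW ha 1 (k - 2 * i - 1) (b := b) (by omega)
    (hP i (Polynomial.mem_support_iff.1 hi))
  rwa [sub_add_cancel] at this

end PolyScaled

/-- The `H`-valued functions which, away from `0`, take values in `exp(s² N) F^p + G^q`. -/
def expSections (N : Module.End ℂ H) (F G : ℤ → Submodule ℂ H) (p q : ℤ) :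
    Submodule ℂ (ℂ → H) :=
  Submodule.pi {0}ᶜ fun s => expFiltration N F (s ^ 2) p ⊔ G q

namespace IsMonodromyOpposed

variable {N : Module.End ℂ H} {d : ℤ} {W F G : ℤ → Submodule ℂ H} {w₀ w₁ p q : ℤ}

/-- Replace t by s²N in t^j ≡ e^t f + g modulo t^{l+1}. The degree bounds put f(s²N)x in F^p and
g(s²N)x' in G^q; the errors from x - x' and from t^{l+1} (by primitivity) have lower weight. -/
theorem scaled_pow_mem_of_primitive (h : IsMonodromyOpposed N d W F G) (hN : IsNilpotent N)
    (h₀ : W w₀ = ⊥) (hpq : p + q = d + 1) (l : ℕ) (hl : d + l ≤ w₁) (a b : ℤ) (hab : a + b = d + l)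
    (x : H) (hx : x ∈ F a) (x' : H) (hx' : x' ∈ G b)
    (hxx : x - x' ∈ W (d + l - 1)) (hprim : (N ^ (l + 1)) x ∈ W (d - l - 3)) (j : ℕ) :
    scaled (d + l - 2 * j) ((N ^ j) x) ∈ expSections N F G p q ⊔ scaledSpan W w₀ w₁ 1 := by
  -- N^i x stays in F^p for i ≤ a - p, which bounds deg f. The complementary bound suits g because b
  -- - (l - (a - p + 1)) = q; the truncations cover f = 0 and g = 0.
  obtain ⟨f, g, hf, hg, hfg⟩ := PowerSeries.exists_exp_mul_add
    (min (a - p + 1).toNat (l + 1)) (l + 1 - min (a - p + 1).toNat (l + 1)) j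
  -- Long enough to give exp(s²N) exactly and to agree with exp modulo t^{l+1}.
  set m := max (nilpotencyClass N) (l + 1) with hm
  set e := PowerSeries.trunc m (PowerSeries.exp ℂ) with he
  set Q : Polynomial ℂ := e * f + g - Polynomial.X ^ j with hQ
  have hQ0 : ∀ i, i < l + 1 → Q.coeff i = 0 := by
    intro i hi
    have h1 : (e * f).coeff i = PowerSeries.coeff i (PowerSeries.exp ℂ * (f : PowerSeries ℂ)) := by
      rw [Polynomial.coeff_mul, PowerSeries.coeff_mul]
      refine Finset.sum_congr rfl fun n hn => ?_
      rw [Finset.HasAntidiagonal.mem_antidiagonal] at hn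
      rw [he, PowerSeries.coeff_trunc, if_pos (by omega), Polynomial.coeff_coe]
    rw [hQ, Polynomial.coeff_sub, Polynomial.coeff_add, h1, hfg i (by omega), sub_self]
  have key : scaled (d + l - 2 * j) ((N ^ j) x) =
      (polyScaled N (d + l) x (e * f) + polyScaled N (d + l) x' g) +
      (polyScaled N (d + l) (x - x') g - polyScaled N (d + l) x Q) := by
    rw [← polyScaled_X_pow, polyScaled_sub, hQ, map_sub, map_add]
    abel
  rw [key]
  refine Submodule.add_mem_sup ?_ (sub_mem ?_ ?_)
  · intro s hs
    have hs : s ≠ 0 := hs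
    refine Submodule.add_mem_sup ?_ ?_
    · rw [polyScaled_apply _ _ hs, map_mul, Module.End.mul_apply, ← map_smul, he,
        ← expNilpotent_eq_aeval hN _ m (le_max_left _ _)]
      refine Submodule.mem_map_of_mem (Submodule.smul_mem _ _
        (aeval_smul_apply_mem h.antitone_left h.shift_left _ hx fun i hi => hf i ?_))
      omega
    · rw [polyScaled_apply _ _ hs]
      refine Submodule.smul_mem _ _
        (aeval_smul_apply_mem h.antitone_right h.shift_right _ hx' fun i hi => hg i ?_)
      omega
  · exact polyScaled_mem_scaledSpan h.monotone h₀ hl fun i _ =>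
      pow_mem_of_shift h.shift i _ _ (by ring) _ hxx
  · refine polyScaled_mem_scaledSpan h.monotone h₀ hl fun i hi => ?_
    have hi' : l + 1 ≤ i := by
      by_contra hlt
      exact hi (hQ0 i (not_le.1 hlt))
    obtain ⟨n, rfl⟩ := Nat.exists_eq_add_of_le hi'
    rw [add_comm (l + 1), pow_add, Module.End.mul_apply]
    exact pow_mem_of_shift h.shift n (d - l - 3) _ (by push_cast; ring) _ hprim

/-- Descending induction on the weight d + l, following the primitive decomposition: a vector of
pure type is primitive up to N y₁ with y₁ of weight d + l + 2, and N^j N y₁ is covered by the case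
(l + 2, j + 1). -/
theorem scaled_pow_mem (h : IsMonodromyOpposed N d W F G) (hN : IsNilpotent N)
    (hF : ∃ p, F p = ⊤) (hF' : ∃ p, F p = ⊥) (h₀ : W w₀ = ⊥) (h₁ : W w₁ = ⊤)
    (hpq : p + q = d + 1) (l j : ℕ) (hj : d + l - 2 * j ≤ w₁) (e : H) (he : e ∈ W (d + l)) :
    scaled (d + l - 2 * j) ((N ^ j) e) ∈ expSections N F G p q ⊔ scaledSpan W w₀ w₁ 1 := by
  induction hn : (w₁ + 1 - (d + l)).toNat using Nat.strong_induction_on generalizing l j e with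
  | _ n ih =>
  have hlow : ∀ (l j : ℕ) (e : H), d + l - 2 * j ≤ w₁ → e ∈ W (d + l - 1) →
      scaled (d + l - 2 * j) ((N ^ j) e) ∈ expSections N F G p q ⊔ scaledSpan W w₀ w₁ 1 := by
    intro l j e hj he
    refine Submodule.mem_sup_right ?_
    have := scaled_mem_scaledSpan h.monotone h₀ 1 (d + l - 2 * j - 1) (b := w₁) (by omega)
      (pow_mem_of_shift h.shift j (d + l - 1) _ (by ring) e he)
    rwa [sub_add_cancel] at this
  rcases lt_or_ge w₁ (d + l) with hl | hl
  · refine hlow l j e hj (h.monotone (show w₁ ≤ d + l - 1 by omega) ?_)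
    rw [h₁]
    trivial
  refine h.weight_le_of_forall_type hF hF' (d + l) (Submodule.comap
    ((scaled (d + l - 2 * j)).comp (N ^ j)) (expSections N F G p q ⊔ scaledSpan W w₀ w₁ 1)) ?_ he
  intro a b hab x hx hxW x' hx' hxW' hxx
  have hv : (N ^ (l + 1)) x ∈ W (d - (l + 2 : ℕ)) :=
    pow_mem_of_shift h.shift _ _ _ (by push_cast; ring) x hxW
  have hv' : (N ^ (l + 1)) x' ∈ W (d - (l + 2 : ℕ)) :=
    pow_mem_of_shift h.shift _ _ _ (by push_cast; ring) x' hxW'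
  -- Strictness for F and for G gives representatives y₁ and y₂ of the class of y, so x - N y₁ and
  -- x' - N y₂ still exhibit type (a, b).
  obtain ⟨y, hy, hyv⟩ := h.surj (l + 2) _ hv
  obtain ⟨y₁, hy₁, hyW₁, hyy₁⟩ := h.exists_sub_mem_of_pow_sub_mem (l + 2) (a + 1) _ rfl y hy _
    (pow_mem_of_shift_one h.shift_left (l + 1) a _ (by push_cast; ring) x hx) hv hyv
  have hyv' : (N ^ (l + 2)) y - (N ^ (l + 1)) x' ∈ W (d - (l + 2 : ℕ) - 1) := by
    have := add_mem hyv (pow_mem_of_shift h.shift (l + 1) _ (d - (l + 2 : ℕ) - 1)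
      (by push_cast; ring) _ hxx)
    rw [map_sub] at this
    simpa using this
  obtain ⟨y₂, hy₂, hyW₂, hyy₂⟩ := h.symm.exists_sub_mem_of_pow_sub_mem (l + 2) (b + 1) _ rfl y hy _
    (pow_mem_of_shift_one h.shift_right (l + 1) b _ (by push_cast; ring) x' hx') hv' hyv'
  have hprim : (N ^ (l + 1)) (x - N y₁) ∈ W (d - l - 3) := by
    have h1 := pow_mem_of_shift h.shift (l + 2) _ (d - (l + 2 : ℕ) - 1) (by push_cast; ring) _ hyy₁
    have h2 := sub_mem h1 hyv
    have h3 : (N ^ (l + 2)) y₁ = (N ^ (l + 1)) (N y₁) := by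
      rw [pow_succ, Module.End.mul_apply]
    rw [map_sub, h3] at h2
    rw [map_sub]
    convert h2 using 1
    · push_cast
      congr 1
      ring
    · abel
  have hxx' : x - N y₁ - (x' - N y₂) ∈ W (d + l - 1) := by
    have h1 := h.shift _ _ (sub_mem hyy₁ hyy₂)
    have h2 := add_mem hxx (h.monotone (show d + ((l + 2 : ℕ) : ℤ) - 1 - 2 ≤ d + l - 1 by
      push_cast; omega) h1)
    convert h2 using 1
    simp only [map_sub]
    abel
  have hFy : N y₁ ∈ F a := by simpa using h.shift_left _ _ hy₁
  have hGy : N y₂ ∈ G b := by simpa using h.shift_right _ _ hy₂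
  have m1 := h.scaled_pow_mem_of_primitive hN h₀ hpq l hl a b hab _ (sub_mem hx hFy) _
    (sub_mem hx' hGy) hxx' hprim j
  have m2 := ih _ (by push_cast; omega) (l + 2) (j + 1) (by push_cast; omega) y₁ hyW₁ rfl
  rw [pow_succ, Module.End.mul_apply, show d + ((l + 2 : ℕ) : ℤ) - 2 * ((j + 1 : ℕ) : ℤ)
    = d + l - 2 * j by push_cast; ring] at m2
  have := add_mem m1 m2
  rw [← map_add, ← map_add, sub_add_cancel] at this
  exact this

theorem scaledSpan_le (h : IsMonodromyOpposed N d W F G) (hN : IsNilpotent N)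
    (hF : ∃ p, F p = ⊤) (hF' : ∃ p, F p = ⊥) (h₀ : W w₀ = ⊥) (h₁ : W w₁ = ⊤)
    (hpq : p + q = d + 1) :
    scaledSpan W w₀ w₁ 0 ≤ expSections N F G p q ⊔ scaledSpan W w₀ w₁ 1 := by
  refine iSup₂_le fun k hk => ?_
  have hk1 : k ≤ w₁ := (Finset.mem_Icc.1 hk).2
  rintro _ ⟨e, he, rfl⟩
  rw [add_zero]
  rcases le_total d k with hdk | hdk
  · obtain ⟨l, hl⟩ := Int.le.dest hdk
    subst hl
    simpa using h.scaled_pow_mem hN hF hF' h₀ h₁ hpq l 0 (by simpa using hk1) e he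
  · obtain ⟨l, hl⟩ := Int.le.dest hdk
    obtain rfl : k = d - l := by omega
    obtain ⟨y, hy, hye⟩ := h.surj l e he
    have m1 := h.scaled_pow_mem hN hF hF' h₀ h₁ hpq l l (by omega) y hy
    have m2 := scaled_mem_scaledSpan h.monotone h₀ 1 (d - l - 1) (b := w₁) (by omega) hye
    rw [sub_add_cancel] at m2
    rw [show d + (l : ℤ) - 2 * l = d - l by ring] at m1
    have := sub_mem m1 (Submodule.mem_sup_right m2)
    rwa [← map_sub, sub_sub_cancel] at this

/-- `exp(w N) F^p + G^q = H` for all but finitely many `w`, if `p + q = d + 1`. -/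
theorem finite_setOf_expFiltration_sup_ne_top [FiniteDimensional ℂ H]
    (h : IsMonodromyOpposed N d W F G) (hN : IsNilpotent N) (hW : IsFiniteIncreasing W)
    (hF : ∃ p, F p = ⊤) (hF' : ∃ p, F p = ⊥) (hpq : p + q = d + 1) :
    {w : ℂ | expFiltration N F w p ⊔ G q ≠ ⊤}.Finite := by
  obtain ⟨w₀, h₀⟩ := hW.exists_eq_bot
  obtain ⟨w₁, h₁⟩ := hW.exists_eq_top
  have hfin := (scaledSpan_fg W w₀ w₁ 0).finite_setOf_not_forall_mem
    (fun s => expFiltration N F (s ^ 2) p ⊔ G q) (by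
      intro f hf
      obtain ⟨ρ, hρ, g, hg, rfl⟩ := Submodule.mem_sup.1 (h.scaledSpan_le hN hF hF' h₀ h₁ hpq hf)
      obtain ⟨g', hg', hgg⟩ := exists_scaledSpan_zero_eq hg
      refine ⟨g', hg', fun s hs => ?_⟩
      rw [Pi.add_apply, hgg s hs, add_sub_cancel_right]
      exact hρ s hs)
  refine (((Set.finite_singleton 0).union hfin).image fun s => s ^ 2).subset fun w hw => ?_
  obtain ⟨s, rfl⟩ := IsAlgClosed.exists_pow_nat_eq w (n := 2) (by norm_num)
  refine ⟨s, ?_, rfl⟩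
  by_contra hcon
  simp only [Set.singleton_union, Set.mem_insert_iff, Set.mem_ofPred_eq, not_or, not_not] at hcon
  apply hw
  rw [eq_top_iff]
  intro e _
  -- As W_{w₁} = H, every vector e occurs, up to the nonzero factor s^{-w₁}, as a value of the
  -- family.
  have h2 : scaled w₁ e ∈ scaledSpan W w₀ w₁ 0 := by
    simpa using scaled_mem_scaledSpan h.monotone h₀ 0 w₁ le_rfl (e := e) (by rw [h₁]; trivial)
  exact (Submodule.smul_mem_iff _ (zpow_ne_zero _ hcon.1)).1 (hcon.2 _ h2)

end IsMonodromyOpposed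

end Core

/-! ### Complementary dimensions, counted on graded pieces. -/

section Dimension

variable {H : Type*} [AddCommGroup H] [Module ℂ H]

/-- The dimension of the subspace induced by `A` on `Gr^W_k`. -/
def grDim (W : ℤ → Submodule ℂ H) (A : Submodule ℂ H) (k : ℤ) : ℤ :=
  Module.finrank ℂ (A ⊓ W k : Submodule ℂ H) - Module.finrank ℂ (A ⊓ W (k - 1) : Submodule ℂ H)

theorem sum_grDim (W : ℤ → Submodule ℂ H) (A : Submodule ℂ H) (a : ℤ) (n : ℕ) (h₀ : W a = ⊥)
    (h₁ : W (a + n) = ⊤) :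
    ∑ i ∈ Finset.range n, grDim W A (a + 1 + i) = Module.finrank ℂ A := by
  have := Finset.sum_range_sub
    (fun i : ℕ => (Module.finrank ℂ (A ⊓ W (a + i) : Submodule ℂ H) : ℤ)) n
  beta_reduce at this
  rw [h₁, inf_top_eq, Nat.cast_zero, add_zero, h₀, inf_bot_eq, finrank_bot, Nat.cast_zero,
    sub_zero] at this
  rw [← this]
  refine Finset.sum_congr rfl fun i _ => ?_
  rw [grDim, show a + 1 + (i : ℤ) - 1 = a + i by ring,
    show a + 1 + (i : ℤ) = a + (i + 1 : ℕ) by push_cast; ring]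

variable [FiniteDimensional ℂ H]

theorem Submodule.finrank_map_add_finrank_inf_ker {V : Type*} [AddCommGroup V] [Module ℂ V]
    (f : H →ₗ[ℂ] V) (A : Submodule ℂ H) :
    Module.finrank ℂ (A.map f) + Module.finrank ℂ (A ⊓ LinearMap.ker f : Submodule ℂ H)
      = Module.finrank ℂ A := by
  rw [← LinearMap.finrank_range_add_finrank_ker (f.domRestrict A), LinearMap.range_domRestrict,
    LinearMap.ker_domRestrict, ← Submodule.finrank_map_subtype_eq A, Submodule.map_comap_subtype]

namespace IsMonodromyOpposed

variable {N : Module.End ℂ H} {d : ℤ} {W F G : ℤ → Submodule ℂ H}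

theorem grDim_add_grDim (h : IsMonodromyOpposed N d W F G) {k p q : ℤ} (hpq : p + q = k + 1) :
    grDim W (F p) k + grDim W (G q) k = grDim W ⊤ k := by
  have hW : W (k - 1) ≤ W k := h.monotone (by omega)
  have e1 := Submodule.finrank_sup_add_finrank_inf_eq (F p ⊓ W k) (W (k - 1))
  have e2 := Submodule.finrank_sup_add_finrank_inf_eq (G q ⊓ W k) (W (k - 1))
  have e3 := Submodule.finrank_sup_add_finrank_inf_eq
    (F p ⊓ W k ⊔ W (k - 1)) (G q ⊓ W k ⊔ W (k - 1))
  have hsup : (F p ⊓ W k ⊔ W (k - 1)) ⊔ (G q ⊓ W k ⊔ W (k - 1)) = W k := by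
    refine le_antisymm (sup_le (sup_le inf_le_right hW) (sup_le inf_le_right hW)) fun x hx => ?_
    obtain ⟨y, hy, hy', z, hz, hz', hxyz⟩ := h.exists_add k p q hpq x hx
    have : x = y + (z + (x - y - z)) := by abel
    rw [this]
    exact Submodule.add_mem_sup (Submodule.mem_sup_left ⟨hy, hy'⟩)
      (Submodule.add_mem_sup ⟨hz, hz'⟩ hxyz)
  have hinf : (F p ⊓ W k ⊔ W (k - 1)) ⊓ (G q ⊓ W k ⊔ W (k - 1)) = W (k - 1) := by
    refine le_antisymm ?_ (le_inf le_sup_right le_sup_right)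
    rintro x ⟨h1, h2⟩
    obtain ⟨y, ⟨hy, hy'⟩, u, hu, rfl⟩ := Submodule.mem_sup.1 h1
    obtain ⟨z, ⟨hz, hz'⟩, v, hv, hzv⟩ := Submodule.mem_sup.1 h2
    have : y - z = v - u := by
      rw [sub_eq_sub_iff_add_eq_add, ← hzv, add_comm]
    exact add_mem (h.mem_of_sub_mem k p q hpq y hy hy' z hz hz' (this ▸ sub_mem hv hu)) hu
  rw [hsup, hinf] at e3
  rw [inf_assoc, inf_eq_right.2 hW] at e1 e2
  rw [grDim, grDim, grDim, top_inf_eq, top_inf_eq]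
  omega

/-- By strictness N^l maps the part of F^p in weight d + l isomorphically onto that of F^{p-l} in
weight d - l. -/
theorem grDim_sub_eq_grDim_add (h : IsMonodromyOpposed N d W F G) (l : ℕ) (p : ℤ) :
    grDim W (F (p - l)) (d - l) = grDim W (F p) (d + l) := by
  have hle : W (d + l - 1) ≤ W (d + l) := h.monotone (by omega)
  have hle' : W (d - l - 1) ≤ W (d - l) := h.monotone (by omega)
  have e1 := Submodule.finrank_map_add_finrank_inf_ker (W (d - l - 1)).mkQ (F (p - l) ⊓ W (d - l))
  have e2 := Submodule.finrank_map_add_finrank_inf_ker ((W (d - l - 1)).mkQ.comp (N ^ l))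
    (F p ⊓ W (d + l))
  have hmap : (F (p - l) ⊓ W (d - l)).map (W (d - l - 1)).mkQ
      = (F p ⊓ W (d + l)).map ((W (d - l - 1)).mkQ.comp (N ^ l)) := by
    apply le_antisymm
    · rintro _ ⟨v, ⟨hv, hv'⟩, rfl⟩
      obtain ⟨x, hx, hxv⟩ := h.surj l v hv'
      obtain ⟨y, hy, hy', hxy⟩ := h.exists_sub_mem_of_pow_sub_mem l p _ rfl x hx v hv hv' hxv
      refine ⟨y, ⟨hy, hy'⟩, ?_⟩
      rw [LinearMap.comp_apply, Submodule.mkQ_apply, Submodule.mkQ_apply, Submodule.Quotient.eq]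
      have := sub_mem hxv (pow_mem_of_shift h.shift l _ (d - l - 1) (by ring) _ hxy)
      rw [map_sub] at this
      convert this using 1
      abel
    · rintro _ ⟨y, ⟨hy, hy'⟩, rfl⟩
      exact ⟨(N ^ l) y, ⟨pow_mem_of_shift_one h.shift_left l p _ rfl y hy,
        pow_mem_of_shift h.shift l _ _ (by ring) y hy'⟩, rfl⟩
  have hker : F p ⊓ W (d + l) ⊓ LinearMap.ker ((W (d - l - 1)).mkQ.comp (N ^ l))
      = F p ⊓ W (d + l - 1) := by
    ext x
    simp only [Submodule.mem_inf, LinearMap.mem_ker, LinearMap.comp_apply, Submodule.mkQ_apply,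
      Submodule.Quotient.mk_eq_zero]
    constructor
    · rintro ⟨⟨hx, hx'⟩, hNx⟩
      exact ⟨hx, h.inj l x hx' hNx⟩
    · rintro ⟨hx, hx'⟩
      exact ⟨⟨hx, hle hx'⟩, pow_mem_of_shift h.shift l _ _ (by ring) x hx'⟩
  rw [Submodule.ker_mkQ, inf_assoc, inf_eq_right.2 hle', hmap] at e1
  rw [hker] at e2
  simp only [grDim]
  omega

theorem grDim_reflect (h : IsMonodromyOpposed N d W F G) (k p : ℤ) :
    grDim W (F p) (2 * d - k) = grDim W (F (p + k - d)) k := by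
  rcases le_total d k with hdk | hdk
  · obtain ⟨l, hl⟩ := Int.le.dest hdk
    subst hl
    have := h.grDim_sub_eq_grDim_add l (p + l)
    rwa [add_sub_cancel_right, show d - (l : ℤ) = 2 * d - (d + l) by ring,
      show p + (l : ℤ) = p + (d + l) - d by ring] at this
  · obtain ⟨l, hl⟩ := Int.le.dest hdk
    obtain rfl : k = d - l := by omega
    rw [show p + (d - (l : ℤ)) - d = p - l by ring, show 2 * d - (d - (l : ℤ)) = d + l by ring]
    exact (h.grDim_sub_eq_grDim_add l p).symm

theorem finrank_add_finrank (h : IsMonodromyOpposed N d W F G) (hW : IsFiniteIncreasing W)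
    {p q : ℤ} (hpq : p + q = d + 1) :
    Module.finrank ℂ (F p) + Module.finrank ℂ (G q) = Module.finrank ℂ H := by
  obtain ⟨w₀, h₀⟩ := hW.exists_eq_bot
  obtain ⟨w₁, h₁⟩ := hW.exists_eq_top
  -- The range d - m, …, d + m contains all weights and is symmetric about d, so the sum for G^q may
  -- be reversed: weight k of F^p is paired with weight 2d - k of G^q, that is, with weight k of
  -- G^{q+k-d}.
  set m : ℕ := (d - 1 - w₀).toNat + (w₁ - d).toNat with hm
  have h₀' : W (d - m - 1) = ⊥ := le_bot_iff.1 (h₀ ▸ h.monotone (by omega))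
  have h₁' : W (d - m - 1 + (2 * m + 1 : ℕ)) = ⊤ :=
    top_le_iff.1 (h₁ ▸ h.monotone (by push_cast; omega))
  have e1 := sum_grDim W (F p) _ _ h₀' h₁'
  have e2 := sum_grDim W (G q) _ _ h₀' h₁'
  have e3 := sum_grDim W ⊤ _ _ h₀' h₁'
  rw [← Finset.sum_range_reflect] at e2
  rw [finrank_top] at e3
  have : (Module.finrank ℂ (F p) : ℤ) + Module.finrank ℂ (G q) = Module.finrank ℂ H := by
    rw [← e1, ← e2, ← e3, ← Finset.sum_add_distrib]
    refine Finset.sum_congr rfl fun i hi => ?_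
    have hi : i < 2 * m + 1 := Finset.mem_range.1 hi
    have hcast : d - (m : ℤ) - 1 + 1 + ((2 * m + 1 - 1 - i : ℕ) : ℤ)
        = 2 * d - (d - m - 1 + 1 + i) := by omega
    rw [hcast, h.symm.grDim_reflect]
    exact h.grDim_add_grDim (by omega)
  exact_mod_cast this

end IsMonodromyOpposed

end Dimension

/-! ### From mixed Hodge structures to conditions on elements. -/

section MixedHodge

variable {H : Type*} [AddCommGroup H] [Module ℂ H]

theorem gr_mkQ_eq_iff {W : ℤ → Submodule ℂ H} {k : ℤ} {x y : W k} :
    ((W (k - 1)).submoduleOf (W k)).mkQ x = ((W (k - 1)).submoduleOf (W k)).mkQ y ↔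
      (x : H) - y ∈ W (k - 1) :=
  Submodule.Quotient.eq _

theorem gr_mkQ_eq_zero_iff {W : ℤ → Submodule ℂ H} {k : ℤ} {x : W k} :
    ((W (k - 1)).submoduleOf (W k)).mkQ x = 0 ↔ (x : H) ∈ W (k - 1) :=
  Submodule.Quotient.mk_eq_zero _

theorem mkQ_mem_grFiltration {W F : ℤ → Submodule ℂ H} {k p : ℤ} (x : W k) :
    ((W (k - 1)).submoduleOf (W k)).mkQ x ∈ grFiltration W F k p ↔
      ∃ y ∈ F p, y ∈ W k ∧ (x : H) - y ∈ W (k - 1) := by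
  constructor
  · rintro ⟨y, hy, hyx⟩
    exact ⟨y, hy, y.2, gr_mkQ_eq_iff.1 hyx.symm⟩
  · rintro ⟨y, hy, hy', hxy⟩
    exact ⟨⟨y, hy'⟩, hy, (gr_mkQ_eq_iff.2 hxy).symm⟩

theorem RealStructure.mem_conjSubmodule (σ : RealStructure H) {S : Submodule ℂ H} {x : H} :
    x ∈ σ.conjSubmodule S ↔ σ.conj x ∈ S := by
  constructor
  · rintro ⟨y, hy, rfl⟩
    rwa [σ.conj_conj]
  · exact fun hx => ⟨_, hx, σ.conj_conj x⟩

theorem mkQ_mem_conjSubmodule_grFiltration (σ : RealStructure H) {W F : ℤ → Submodule ℂ H}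
    (hW : ∀ k, ∀ x ∈ W k, σ.conj x ∈ W k) {k p : ℤ} (x : W k) :
    ((W (k - 1)).submoduleOf (W k)).mkQ x ∈ (σ.gr W hW k).conjSubmodule (grFiltration W F k p) ↔
      ∃ y ∈ σ.conjSubmodule (F p), y ∈ W k ∧ (x : H) - y ∈ W (k - 1) := by
  rw [RealStructure.mem_conjSubmodule]
  refine (mkQ_mem_grFiltration (⟨σ.conj x, hW k x x.2⟩ : W k)).trans ⟨?_, ?_⟩
  · rintro ⟨y, hy, hy', hxy⟩
    refine ⟨σ.conj y, ⟨y, hy, rfl⟩, hW k y hy', ?_⟩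
    simpa [σ.conj_conj] using hW _ _ hxy
  · rintro ⟨y, hy, hy', hxy⟩
    refine ⟨σ.conj y, (σ.mem_conjSubmodule).1 hy, hW k y hy', ?_⟩
    simpa using hW _ _ hxy

theorem IsRealMixedHodgeStructure.isMonodromyOpposed {σ : RealStructure H}
    {W F : ℤ → Submodule ℂ H} (hMHS : IsRealMixedHodgeStructure σ W F) {N : Module.End ℂ H}
    (hN : IsMorphismOfType σ W F N (-1)) {d : ℤ} (hW : IsMonodromyWeightFiltration N d W) :
    IsMonodromyOpposed N d W F (fun p => σ.conjSubmodule (F p)) where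
  monotone := hW.finite.monotone
  antitone_left := hMHS.hodge_finite.antitone
  antitone_right p q hpq := Submodule.map_mono (hMHS.hodge_finite.antitone hpq)
  shift := hW.shift
  shift_left := hN.map_hodge
  shift_right := by
    rintro p _ ⟨x, hx, rfl⟩
    rw [hN.map_conj]
    exact ⟨_, hN.map_hodge p x hx, rfl⟩
  exists_add k p q hpq x hx := by
    obtain rfl : q = k - p + 1 := by omega
    have htop := ((hMHS.pure_gr k).opposed p).sup_eq_top
    obtain ⟨u, hu, v, hv, huv⟩ := Submodule.mem_sup.1
      (htop.ge (Submodule.mem_top (x := ((W (k - 1)).submoduleOf (W k)).mkQ ⟨x, hx⟩)))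
    obtain ⟨u, rfl⟩ := Submodule.mkQ_surjective _ u
    obtain ⟨v, rfl⟩ := Submodule.mkQ_surjective _ v
    obtain ⟨y, hy, hy', huy⟩ := (mkQ_mem_grFiltration u).1 hu
    obtain ⟨z, hz, hz', hvz⟩ := (mkQ_mem_conjSubmodule_grFiltration σ hMHS.weight_real v).1 hv
    refine ⟨y, hy, hy', z, hz, hz', ?_⟩
    rw [← map_add] at huv
    have h1 : (u : H) + v - x ∈ W (k - 1) := gr_mkQ_eq_iff.1 huv
    convert sub_mem (add_mem huy hvz) h1 using 1
    abel
  mem_of_sub_mem k p q hpq y hy hy' z hz hz' hyz := by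
    obtain rfl : q = k - p + 1 := by omega
    have hbot := ((hMHS.pure_gr k).opposed p).inf_eq_bot
    have h1 : ((W (k - 1)).submoduleOf (W k)).mkQ ⟨y, hy'⟩ ∈ grFiltration W F k p :=
      (mkQ_mem_grFiltration _).2 ⟨y, hy, hy', by simp⟩
    have h2 := (mkQ_mem_conjSubmodule_grFiltration σ hMHS.weight_real (p := k - p + 1)
      (⟨y, hy'⟩ : W k)).2 ⟨z, hz, hz', hyz⟩
    have h3 := hbot.le ⟨h1, h2⟩
    exact gr_mkQ_eq_zero_iff.1 h3
  surj l y hy := by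
    obtain ⟨x, hx⟩ := (hW.bijective l).2 (((W (d - l - 1)).submoduleOf (W (d - l))).mkQ ⟨y, hy⟩)
    obtain ⟨x, rfl⟩ := Submodule.mkQ_surjective _ x
    exact ⟨x, x.2, gr_mkQ_eq_iff.1 hx⟩
  inj l x hx hNx := by
    have h1 := (hW.bijective l).1 (a₁ := ((W (d + l - 1)).submoduleOf (W (d + l))).mkQ ⟨x, hx⟩)
      (a₂ := 0) (by
        rw [map_zero]
        exact gr_mkQ_eq_zero_iff.2 hNx)
    exact gr_mkQ_eq_zero_iff.1 h1

end MixedHodge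

/-! ### The one-parameter group exp(zN) and conjugation. -/

section ExpGroup

variable {H : Type*} [AddCommGroup H] [Module ℂ H] {N : Module.End ℂ H}

theorem expNilpotent_add (hN : IsNilpotent N) (z w : ℂ) :
    expNilpotent N (z + w) = expNilpotent N z * expNilpotent N w := by
  let _ : Algebra ℚ (Module.End ℂ H) := Algebra.compHom _ (algebraMap ℚ ℂ)
  have hexp : ∀ z, expNilpotent N z = IsNilpotent.exp (z • N) := by
    intro z
    rw [IsNilpotent.exp_eq_sum (k := nilpotencyClass N)
      (by rw [smul_pow, pow_nilpotencyClass hN, smul_zero]), expNilpotent]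
    refine Finset.sum_congr rfl fun k _ => ?_
    have : ∀ (c : ℚ) (T : Module.End ℂ H), c • T = (c : ℂ) • T := fun c T => rfl
    rw [this, smul_pow, smul_smul]
    congr 1
    push_cast
    ring
  rw [hexp, hexp, hexp, add_smul, IsNilpotent.exp_add_of_commute
    ((Commute.refl N).smul_left z |>.smul_right w) (hN.smul z) (hN.smul w)]

theorem expNilpotent_zero (hN : IsNilpotent N) : expNilpotent N 0 = 1 := by
  rw [expNilpotent_eq_aeval hN 0 (nilpotencyClass N + 1) (Nat.le_succ _), zero_smul,
    Polynomial.aeval_def, Polynomial.eval₂_at_zero, PowerSeries.coeff_trunc, if_pos (Nat.succ_pos _)]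
  simp

theorem expNilpotent_conj (σ : RealStructure H) (hN : ∀ x, N (σ.conj x) = σ.conj (N x)) (z : ℂ)
    (x : H) : σ.conj (expNilpotent N z x) = expNilpotent N (starRingEnd ℂ z) (σ.conj x) := by
  have hpow : ∀ k : ℕ, σ.conj ((N ^ k) x) = (N ^ k) (σ.conj x) := by
    intro k
    induction k with
    | zero => simp
    | succ k ih => rw [pow_succ', Module.End.mul_apply, Module.End.mul_apply, ← hN, ih]
  simp [expNilpotent, LinearMap.sum_apply, hpow]

end ExpGroup

end


/-! ### Conclusion. -/

theorem theorem2p3 {H : Type*} [AddCommGroup H] [Module ℂ H] [FiniteDimensional ℂ H]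
    (σ : RealStructure H) (W F : ℤ → Submodule ℂ H) (hMHS : IsRealMixedHodgeStructure σ W F)
    (N : Module.End ℂ H) (hN : IsNilpotent N) (hNtype : IsMorphismOfType σ W F N (-1))
    (d : ℤ) (hW : IsMonodromyWeightFiltration N d W) :
    ∃ C : ℝ, ∀ z : ℂ, C < z.im →
      IsOpposed d (expFiltration N F z) (fun p => σ.conjSubmodule (expFiltration N F z p)) := by
  have h := hMHS.isMonodromyOpposed hNtype hW
  have hF := hMHS.hodge_finite
  obtain ⟨p₀, hp₀⟩ := hF.exists_eq_top
  obtain ⟨p₁, hp₁⟩ := hF.exists_eq_bot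
  have hunit : ∀ z w : ℂ, z + w = 0 → expNilpotent N z * expNilpotent N w = 1 := fun z w hzw => by
    rw [← expNilpotent_add hN, hzw, expNilpotent_zero hN]
  have hinj : ∀ z, Function.Injective (expNilpotent N z) := fun z =>
    Function.LeftInverse.injective (g := expNilpotent N (-z)) fun x =>
      LinearMap.congr_fun (hunit (-z) z (neg_add_cancel z)) x
  have hdim : ∀ z p, Module.finrank ℂ (expFiltration N F z p) = Module.finrank ℂ (F p) :=
    fun z p => (Submodule.equivMapOfInjective _ (hinj z) (F p)).finrank_eq.symm
  have hconj : ∀ z p, σ.conjSubmodule (expFiltration N F z p) =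
      (σ.conjSubmodule (F p)).map (expNilpotent N (starRingEnd ℂ z)) := by
    intro z p
    ext x
    constructor
    · rintro ⟨_, ⟨y, hy, rfl⟩, rfl⟩
      exact ⟨σ.conj y, ⟨y, hy, rfl⟩, (expNilpotent_conj σ hNtype.map_conj z y).symm⟩
    · rintro ⟨_, ⟨y, hy, rfl⟩, rfl⟩
      exact ⟨_, ⟨y, hy, rfl⟩, expNilpotent_conj σ hNtype.map_conj z y⟩
  have hdim' : ∀ z p, Module.finrank ℂ (σ.conjSubmodule (expFiltration N F z p)) =
      Module.finrank ℂ (σ.conjSubmodule (F p)) := by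
    intro z p
    rw [hconj]
    exact (Submodule.equivMapOfInjective _ (hinj _) _).finrank_eq.symm
  -- Only finitely many p matter: below p₀ the first summand is H, and above p₁ the dimension count
  -- makes the second one H.
  have hfin : (⋃ p ∈ Finset.Icc p₀ p₁,
      {w : ℂ | expFiltration N F w p ⊔ σ.conjSubmodule (F (d - p + 1)) ≠ ⊤}).Finite :=
    Set.Finite.biUnion (Finset.finite_toSet _) fun p _ =>
      h.finite_setOf_expFiltration_sup_ne_top hN hW.finite hF.exists_eq_top hF.exists_eq_bot
        (by ring)
  obtain ⟨C, hC⟩ := (hfin.image Complex.im).bddAbove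
  -- The half comes from Im(z - z̄) = 2 Im z.
  refine ⟨C / 2, fun z hz p => ?_⟩
  have hsum : Module.finrank ℂ (F p) + Module.finrank ℂ (σ.conjSubmodule (F (d - p + 1))) =
      Module.finrank ℂ H := h.finrank_add_finrank hW.finite (by ring)
  have htop : expFiltration N F (z - starRingEnd ℂ z) p ⊔ σ.conjSubmodule (F (d - p + 1)) = ⊤ := by
    rcases lt_or_ge p p₀ with hp | hp
    · have : F p = ⊤ := top_le_iff.1 (hp₀ ▸ hF.antitone hp.le)
      have h1 : expFiltration N F (z - starRingEnd ℂ z) p = ⊤ :=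
        Submodule.eq_top_of_finrank_eq (by rw [hdim, this, finrank_top])
      rw [h1, top_sup_eq]
    rcases lt_or_ge p₁ p with hp' | hp'
    · have : F p = ⊥ := le_bot_iff.1 (hp₁ ▸ hF.antitone hp'.le)
      rw [this, finrank_bot, zero_add] at hsum
      rw [Submodule.eq_top_of_finrank_eq hsum, sup_top_eq]
    by_contra hne
    have h1 := hC ⟨z - starRingEnd ℂ z,
      Set.mem_biUnion (Finset.mem_coe.2 (Finset.mem_Icc.2 ⟨hp, hp'⟩)) hne, rfl⟩
    rw [Complex.sub_im, Complex.conj_im] at h1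
    linarith
  have hsup : expFiltration N F z p ⊔ σ.conjSubmodule (expFiltration N F z (d - p + 1)) = ⊤ := by
    have h1 := congrArg (Submodule.map (expNilpotent N (starRingEnd ℂ z))) htop
    rw [Submodule.map_sup, ← hconj, expFiltration, ← Submodule.map_comp, ← Module.End.mul_eq_comp,
      ← expNilpotent_add hN, add_sub_cancel] at h1
    refine h1.trans ?_
    exact Submodule.eq_top_of_finrank_eq
      ((Submodule.equivMapOfInjective _ (hinj _) ⊤).finrank_eq.symm.trans (finrank_top ℂ H))
  change IsCompl (expFiltration N F z p) (σ.conjSubmodule (expFiltration N F z (d - p + 1)))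
  refine ⟨disjoint_iff.2 ?_, codisjoint_iff.2 hsup⟩
  have h1 := Submodule.finrank_sup_add_finrank_inf_eq (expFiltration N F z p)
    (σ.conjSubmodule (expFiltration N F z (d - p + 1)))
  rw [hsup, finrank_top, hdim, hdim', hsum] at h1
  exact Submodule.finrank_eq_zero.1 (by omega)
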